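/- Let $(R,\mathfrak m)$ be a two-dimensional (Noetherian) Cohen–Macaulay local ring with infinite residue field and let $I$ be an $\mathfrak m$-primary ideal of $R$. For all large $r,s$ the length $\ell(R/\mathfrak m^rI^s)$ is given by a polynomial $\sum_{i+j\le 2}e_{ij}\binom{r+i}{i}\binom{s+j}{j}$ with integers $e_{ij}$; put $e_1(\mathfrak m|I)=e_{11}$. Suppose that $I$ has minimal mixed multiplicity, i.e. $\mu(I)=e_1(\mathfrak m|I)+1$, where $\mu(I)$ is the minimal number of generators of $I$. Let $F(I)=\bigoplus_{n\ge0}I^n/\mathfrak mI^n$ be the fiber cone and $G(I)=\bigoplus_{n\ge0}I^n/I^{n+1}$ the associated graded ring of $I$. (1) Let $(x,a)$ be a joint reduction of $(\mathfrak m,I)$, i.e. $x\in\mathfrak m$, $a\in I$ and $(xI+a\mathfrak m)(\mathfrak mI)^{n-1}=(\mathfrak mI)^n$ for some $n\ge1$. Let $a^{o}\in I/\mathfrak mI$ and $a^{*}\in I/I^2$ be the images of $a$ in the degree-one components of $F(I)$ and $G(I)$. If $a^{o}$ is a regular element (a nonzerodivisor) of $F(I)$, then $a^{*}$ is a regular element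 of $G(I)$. (2) If $\operatorname{depth}F(I)\ge1$, then $\operatorname{depth}G(I)\ge1$, where the depth of each of these graded rings is the supremum of the lengths of the regular sequences contained in its maximal homogeneous ideal. -/

import Mathlib

open IsLocalRing

noncomputable section

namespace BlowupDepth

universe u

/-- The grade of an ideal `J` of a commutative ring `A`: the supremum of the lengths of the
`A`-regular sequences contained in `J`. -/
def idealGrade {A : Type u} [CommRing A] (J : Ideal A) : ℕ∞ :=
  ⨆ (rs : List A) (_ : RingTheory.Sequence.IsRegular A rs ∧ ∀ r ∈ rs, r ∈ J), (rs.length : ℕ∞)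

/-- A local ring is Cohen-Macaulay if it is Noetherian and its depth (the grade of its maximal
ideal) equals its Krull dimension. -/
def IsCohenMacaulayLocal (R : Type u) [CommRing R] [IsLocalRing R] : Prop :=
  IsNoetherianRing R ∧ ((idealGrade (maximalIdeal R) : ℕ∞) : WithBot ℕ∞) = ringKrullDim R

section Multiplicity

variable {R : Type u} [CommRing R]

/-- For all large `r` and `s`, the length of `R / J ^ r I ^ s` is finite and equal to
`∑_{i + j ≤ d} e i j * (r + i choose i) * (s + j choose j)`. -/
def IsBhattacharyaPolynomial (d : ℕ) (J I : Ideal R) (e : ℕ → ℕ → ℤ) : Prop :=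
  ∃ N : ℕ, ∀ r ≥ N, ∀ s ≥ N, ∃ l : ℕ,
    Module.length R (R ⧸ (J ^ r * I ^ s)) = (l : ℕ∞) ∧
    (l : ℤ) = ∑ i ∈ Finset.range (d + 1), ∑ j ∈ Finset.range (d + 1 - i),
      e i j * ((r + i).choose i : ℤ) * ((s + j).choose j : ℤ)

open Classical in
/-- The mixed multiplicity of `i` copies of `J` and `j` copies of `I`, in a local ring of dimension
`i + j`: the coefficient `e i j` of the polynomial that gives the length of `R / J ^ r I ^ s` for
all large `r` and `s`. (For ideals primary to the maximal ideal of a Noetherian local ring of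
dimension `i + j` this polynomial exists and its coefficients are unique.) -/
def mixedMultiplicity (J I : Ideal R) (i j : ℕ) : ℤ :=
  if h : ∃ e : ℕ → ℕ → ℤ, IsBhattacharyaPolynomial (i + j) J I e then h.choose i j else 0

/-- `I` has minimal mixed multiplicity: `μ(I) = e_{d - 1}(𝔪 | I) + d - 1`, where `d = k + 1` is the
dimension of `R`, `μ(I)` is the minimal number of generators of `I`, and `e_{d - 1}(𝔪 | I)` is the
mixed multiplicity of one copy of `𝔪` and `d - 1` copies of `I`. -/
def HasMinimalMixedMultiplicity [IsLocalRing R] (I : Ideal R) : Prop :=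
  ∃ k : ℕ, ringKrullDim R = ((k + 1 : ℕ) : WithBot ℕ∞) ∧
    (I.spanFinrank : ℤ) = mixedMultiplicity (maximalIdeal R) I 1 k + k

/-- `x 1, …, x d` is a joint reduction of the ideals `I 1, …, I d`. The exponent `n - 1` with
`n` positive is written as `n`. -/
def IsJointReduction {d : ℕ} (I : Fin d → Ideal R) (x : Fin d → R) : Prop :=
  (∀ j, x j ∈ I j) ∧
    ∃ n : ℕ, (∑ j, Ideal.span {x j} * ∏ i ∈ Finset.univ.erase j, I i) * (∏ i, I i) ^ n =
      (∏ i, I i) ^ (n + 1)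

end Multiplicity

section Blowup

variable {R : Type u} [CommRing R]

/-- The ring `R[It] / J R[It] = R[It] ⊗ R / J = ⨁ₙ I ^ n / J I ^ n`. -/
abbrev BlowupRing (I J : Ideal R) : Type u :=
  reesAlgebra I ⧸ J.map (algebraMap R (reesAlgebra I))

/-- The associated graded ring `G(I) = R[It] / I R[It] = ⨁ₙ I ^ n / I ^ (n + 1)`. -/
abbrev AssocGraded (I : Ideal R) : Type u := BlowupRing I I

/-- The fiber cone `F(I) = R[It] / 𝔪 R[It] = ⨁ₙ I ^ n / 𝔪 I ^ n`. -/
abbrev FiberCone [IsLocalRing R] (I : Ideal R) : Type u := BlowupRing I (maximalIdeal R)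

/-- The class, in the degree one component `I / J I` of `⨁ₙ I ^ n / J I ^ n`, of an element
`a` of `I`: the image of `a t ∈ R[It]`. -/
def degreeOne (I J : Ideal R) (a : I) : BlowupRing I J :=
  Ideal.Quotient.mk _
    (⟨Polynomial.monomial 1 (a : R), reesAlgebra.monomial_mem.mpr (by simp)⟩ : reesAlgebra I)

/-- The maximal homogeneous ideal `𝔪 ⊕ I t ⊕ I ^ 2 t ^ 2 ⊕ …` of the Rees algebra `R[It]` over a
local ring: the elements with constant coefficient in `𝔪`. -/
def reesMaximalIdeal [IsLocalRing R] (I : Ideal R) : Ideal (reesAlgebra I) :=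
  (maximalIdeal R).comap (Polynomial.constantCoeff.comp (reesAlgebra I).val.toRingHom)

/-- The depth of `⨁ₙ I ^ n / J I ^ n`: the grade of its maximal homogeneous ideal, which is
the image of the one of `R[It]`. -/
def blowupDepth [IsLocalRing R] (I J : Ideal R) : ℕ∞ :=
  idealGrade ((reesMaximalIdeal I).map
    (Ideal.Quotient.mk (J.map (algebraMap R (reesAlgebra I)))))

end Blowup

end BlowupDepth

end

noncomputable section

namespace BlowupDepth

/-! ### Length counts: multiplication maps and the Koszul complex -/

section Colength

variable {R : Type*} [CommRing R]

/-! Both parts rest on a pair `(x, a)` with 𝔪^(r+1) I^(s+1) = x 𝔪^r I^(s+1) + a 𝔪^(r+1) I^s for some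
large `r`, `s`. Such a pair generates an 𝔪-primary ideal, so by Cohen–Macaulayness its Koszul
complex is exact in degree one, and `colength_koszul` turns this into length identities. Put ε =
ℓ(R/(x,a)). Comparing with the mixed difference of the Bhattacharya polynomial gives ε ≤ e₁₁, hence
ε + 1 ≤ μ(I), and this forces 𝔪I = xI + a𝔪 (`maximalIdeal_mul_eq`).

The core is `mem_pow_of_mul_mem_pow_succ`, which squeezes μ(Iⁿ). The pair (x, aⁿ) gives μ(Iⁿ) ≤ 1 +
nε. Regularity of aᵒ gives μ(Iⁿ⁺¹) = μ(Iⁿ) + ε + ℓ(Kₙ/Iⁿ), where Kₙ = (Iⁿ⁺¹ : a) ∩ (Iⁿ : x) contains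
Iⁿ. Hence all bounds are equalities and Kₙ = Iⁿ. As x is nilpotent modulo Iⁿ, it follows that Iⁿ⁺¹ :
a = Iⁿ, which is regularity of a*.

For the second part, `exists_reduction_of_one_le_blowupDepth` supplies such a pair with aᵒ regular:
the infinite residue field gives filter-regular elements of degree one, and a degree-two polynomial
has vanishing third differences. -/

/-- The length of `R / J`. -/
abbrev colength (J : Ideal R) : ℕ∞ := Module.length R (R ⧸ J)

theorem mkQ_eq_zero_iff (J : Ideal R) (z : R) : J.mkQ z = 0 ↔ z ∈ J :=
  Submodule.Quotient.mk_eq_zero J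

theorem map_mkQ_eq_bot_iff {N P : Ideal R} : Submodule.map N.mkQ P = ⊥ ↔ P ≤ N := by
  rw [Submodule.eq_bot_iff]
  constructor
  · intro h z hz
    exact (mkQ_eq_zero_iff N z).mp (h _ ⟨z, hz, rfl⟩)
  · rintro h _ ⟨z, hz, rfl⟩
    exact (mkQ_eq_zero_iff N z).mpr (h hz)

theorem length_range_eq {M N : Type*} [AddCommGroup M] [Module R M] [AddCommGroup N] [Module R N]
    (f : M →ₗ[R] N) : Module.length R (LinearMap.range f) = Module.length R (M ⧸ LinearMap.ker f) :=
  f.quotKerEquivRange.length_eq.symm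

theorem length_eq_ker_add_range {M N : Type*} [AddCommGroup M] [Module R M] [AddCommGroup N]
    [Module R N] (f : M →ₗ[R] N) :
    Module.length R M =
      Module.length R (LinearMap.ker f) + Module.length R (LinearMap.range f) :=
  Module.length_eq_add_of_exact (LinearMap.ker f).subtype f.rangeRestrict
    (Submodule.subtype_injective _) f.surjective_rangeRestrict (by
      rw [LinearMap.exact_iff, LinearMap.ker_rangeRestrict, Submodule.range_subtype])

theorem colength_eq_map_add {N P : Ideal R} (h : N ≤ P) :
    colength N = Module.length R (Submodule.map N.mkQ P) + colength P := by
  have h1 := length_eq_ker_add_range (Submodule.factor h)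
  rw [LinearMap.range_eq_top.mpr (Submodule.factor_surjective h), Module.length_top] at h1
  have h2 : LinearMap.ker (Submodule.factor h) = Submodule.map N.mkQ P := by
    ext z
    obtain ⟨z, rfl⟩ := N.mkQ_surjective z
    rw [LinearMap.mem_ker]
    change P.mkQ z = 0 ↔ _
    rw [mkQ_eq_zero_iff]
    constructor
    · exact fun hz => ⟨z, hz, rfl⟩
    · rintro ⟨y, hy, hyz⟩
      rw [← sub_eq_zero, ← map_sub, mkQ_eq_zero_iff] at hyz
      simpa using P.sub_mem hy (h hyz)
  rw [← h2]
  exact h1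

theorem colength_mono {N P : Ideal R} (h : N ≤ P) : colength P ≤ colength N := by
  rw [colength_eq_map_add h]
  exact le_add_self

theorem eq_of_colength_le {N P : Ideal R} (h : N ≤ P) (hfin : colength P ≠ ⊤)
    (hle : colength N ≤ colength P) : N = P := by
  rw [colength_eq_map_add h] at hle
  have h2 : Module.length R (Submodule.map N.mkQ P) = 0 := by
    have : Module.length R (Submodule.map N.mkQ P) + colength P ≤ 0 + colength P := by
      simpa using hle
    simpa using (ENat.add_le_add_iff_right hfin).mp this
  rw [Module.length_eq_zero_iff, Submodule.subsingleton_iff_eq_bot, map_mkQ_eq_bot_iff] at h2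
  exact le_antisymm h h2

/-- Multiplication by `c` embeds P/N in R/N' with image (cP + N')/N'. Written as a sum so that no
finiteness is needed. -/
theorem colength_mul_sup {N P N' : Ideal R} {c : R} (h : N ≤ P)
    (hc : ∀ z ∈ P, c * z ∈ N' ↔ z ∈ N) :
    colength N + colength (Ideal.span {c} * P ⊔ N') = colength P + colength N' := by
  let f : P →ₗ[R] R ⧸ N' := N'.mkQ ∘ₗ LinearMap.mulLeft R c ∘ₗ P.subtype
  let g : P →ₗ[R] R ⧸ N := N.mkQ ∘ₗ P.subtype
  have hker : LinearMap.ker f = LinearMap.ker g := by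
    ext z
    exact (mkQ_eq_zero_iff N' _).trans ((hc z z.2).trans (mkQ_eq_zero_iff N _).symm)
  have hg : LinearMap.range g = Submodule.map N.mkQ P := by
    rw [LinearMap.range_comp, Submodule.range_subtype]
  have hf : LinearMap.range f = Submodule.map N'.mkQ (Ideal.span {c} * P ⊔ N') := by
    rw [Submodule.map_sup (Ideal.span {c} * P) N' N'.mkQ, map_mkQ_eq_bot_iff.mpr le_rfl,
      sup_bot_eq, LinearMap.range_comp, LinearMap.range_comp, Submodule.range_subtype]
    congr 1
    ext z
    simp [Ideal.mem_span_singleton_mul]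
  have h1 := colength_eq_map_add h
  have h2 := colength_eq_map_add (le_sup_right : N' ≤ Ideal.span {c} * P ⊔ N')
  rw [← hg, length_range_eq] at h1
  rw [← hf, length_range_eq, hker] at h2
  rw [h1, h2]
  ring

/-- The Koszul complex of `x`, `a` is exact in degree one. -/
def KoszulExact (x a : R) : Prop :=
  ∀ u v : R, x * u + a * v = 0 → ∃ t, u = a * t ∧ v = -(x * t)

/-- Additivity of length along 0 → R/K → R/A ⊕ R/B → (x,a)/(xA + aB) → 0, with maps t ↦ (at, −xt)
and (u,v) ↦ xu + av; Koszul exactness gives exactness in the middle. -/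
theorem colength_koszul {x a : R} (hk : KoszulExact x a) {A B K : Ideal R}
    (hK : ∀ w, w ∈ K ↔ a * w ∈ A ∧ x * w ∈ B) :
    colength A + colength B + colength (Ideal.span {x, a}) =
      colength K + colength (Ideal.span {x} * A ⊔ Ideal.span {a} * B) := by
  set Q := Ideal.span {x} * A ⊔ Ideal.span {a} * B with hQ
  have hA : A ≤ Submodule.comap (LinearMap.mulLeft R x) Q := fun u hu =>
    Ideal.mem_sup_left (Ideal.mul_mem_mul (Ideal.mem_span_singleton_self x) hu)
  have hB : B ≤ Submodule.comap (LinearMap.mulLeft R a) Q := fun u hu =>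
    Ideal.mem_sup_right (Ideal.mul_mem_mul (Ideal.mem_span_singleton_self a) hu)
  let g : ((R ⧸ A) × (R ⧸ B)) →ₗ[R] R ⧸ Q :=
    LinearMap.coprod (Submodule.mapQ A Q (LinearMap.mulLeft R x) hA)
      (Submodule.mapQ B Q (LinearMap.mulLeft R a) hB)
  have hg (u v : R) : g (A.mkQ u, B.mkQ v) = Q.mkQ (x * u + a * v) := rfl
  let f : R →ₗ[R] (R ⧸ A) × (R ⧸ B) :=
    LinearMap.prod (A.mkQ ∘ₗ LinearMap.mulLeft R a) (B.mkQ ∘ₗ LinearMap.mulLeft R (-x))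
  have hf (t : R) : f t = (A.mkQ (a * t), B.mkQ (-x * t)) := rfl
  have hkf : LinearMap.ker f = K := by
    ext w
    rw [LinearMap.mem_ker, hf, hK, Prod.mk_eq_zero, mkQ_eq_zero_iff, mkQ_eq_zero_iff, neg_mul,
      neg_mem_iff]
  have hgf : LinearMap.ker g = LinearMap.range f := by
    ext ⟨u, v⟩
    obtain ⟨u, rfl⟩ := A.mkQ_surjective u
    obtain ⟨v, rfl⟩ := B.mkQ_surjective v
    rw [LinearMap.mem_ker, hg, mkQ_eq_zero_iff]
    constructor
    · intro h
      rw [hQ, Submodule.mem_sup] at h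
      obtain ⟨_, hy, _, hz, hyz⟩ := h
      rw [Ideal.mem_span_singleton_mul] at hy hz
      obtain ⟨y, hy, rfl⟩ := hy
      obtain ⟨z, hz, rfl⟩ := hz
      obtain ⟨t, ht, ht'⟩ := hk (u - y) (v - z) (by linear_combination -hyz)
      refine ⟨t, ?_⟩
      rw [hf, Prod.mk.injEq, ← sub_eq_zero, ← map_sub, ← sub_eq_zero (b := B.mkQ v), ← map_sub,
        mkQ_eq_zero_iff, mkQ_eq_zero_iff, ← ht, neg_mul, ← ht']
      simpa using ⟨hy, hz⟩
    · rintro ⟨t, ht⟩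
      rw [← mkQ_eq_zero_iff, ← hg, ← ht, hf, hg, mkQ_eq_zero_iff]
      convert Q.zero_mem using 1
      ring
  have hrg : LinearMap.range g = Submodule.map Q.mkQ (Ideal.span {x, a}) := by
    ext z
    constructor
    · rintro ⟨⟨u, v⟩, rfl⟩
      obtain ⟨u, rfl⟩ := A.mkQ_surjective u
      obtain ⟨v, rfl⟩ := B.mkQ_surjective v
      exact ⟨x * u + a * v, Ideal.mem_span_pair.mpr ⟨u, v, by ring⟩, (hg u v).symm⟩
    · rintro ⟨w, hw, rfl⟩
      obtain ⟨u, v, rfl⟩ := Ideal.mem_span_pair.mp hw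
      exact ⟨(A.mkQ u, B.mkQ v), by rw [hg, mul_comm x, mul_comm a]⟩
  have hQle : Q ≤ Ideal.span {x, a} :=
    sup_le ((Ideal.mul_le_left (I := Ideal.span {x})).trans (Ideal.span_mono (by simp : ({x} : Set R) ⊆ {x, a})))
      ((Ideal.mul_le_left (I := Ideal.span {a})).trans (Ideal.span_mono (by simp : ({a} : Set R) ⊆ {x, a})))
  have h1 := length_eq_ker_add_range g
  have h2 := colength_eq_map_add hQle
  rw [Module.length_prod, hgf, length_range_eq, hkf, hrg] at h1
  rw [h2, ← add_assoc, ← h1]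

theorem KoszulExact.pow {x a : R} (hk : KoszulExact x a) (n : ℕ) : KoszulExact x (a ^ n) := by
  induction n with
  | zero => exact fun u v h => ⟨u, by simp, by linear_combination h⟩
  | succ n ih =>
    intro u v h
    obtain ⟨t, ht, ht'⟩ := hk u (a ^ n * v) (by linear_combination h)
    obtain ⟨s, hs, hs'⟩ := ih t v (by linear_combination ht')
    exact ⟨s, by rw [ht, hs]; ring, hs'⟩

/-- Multiplication by aⁿ maps R/(x,a) onto (x,aⁿ)/(x,aⁿ⁺¹). -/
theorem colength_span_pair_pow_le (x a : R) (n : ℕ) :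
    colength (Ideal.span {x, a ^ n}) ≤ n * colength (Ideal.span {x, a}) := by
  induction n with
  | zero =>
    have : Ideal.span {x, a ^ 0} = ⊤ := Ideal.eq_top_of_isUnit_mem _
      (Ideal.subset_span (by simp)) (isUnit_one : IsUnit (1 : R))
    rw [this]
    simp
  | succ n ih =>
    have hle : Ideal.span {x, a ^ (n + 1)} ≤ Ideal.span {x, a ^ n} := by
      rw [Ideal.span_le]
      rintro _ (rfl | rfl)
      · exact Ideal.subset_span (by simp)
      · rw [pow_succ]
        exact Ideal.mul_mem_right _ _ (Ideal.subset_span (by simp))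
    rw [colength_eq_map_add hle, add_comm, Nat.cast_add, Nat.cast_one, add_mul, one_mul]
    refine add_le_add ih ?_
    set N := Ideal.span {x, a ^ (n + 1)}
    have hx : x ∈ N := Ideal.subset_span (by simp)
    have ha : a ^ (n + 1) ∈ N := Ideal.subset_span (by simp)
    let f : (R ⧸ Ideal.span {x, a}) →ₗ[R] R ⧸ N :=
      Submodule.mapQ _ N (LinearMap.mulLeft R (a ^ n)) (by
        intro z hz
        obtain ⟨u, v, rfl⟩ := Ideal.mem_span_pair.mp hz
        have : a ^ n * (u * x + v * a) = a ^ n * u * x + v * a ^ (n + 1) := by ring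
        simp only [Submodule.mem_comap, LinearMap.mulLeft_apply, this]
        exact N.add_mem (N.mul_mem_left _ hx) (N.mul_mem_left _ ha))
    have hr : Submodule.map N.mkQ (Ideal.span {x, a ^ n}) ≤ LinearMap.range f := by
      rintro _ ⟨z, hz, rfl⟩
      obtain ⟨u, v, rfl⟩ := Ideal.mem_span_pair.mp hz
      refine ⟨Submodule.Quotient.mk v, ?_⟩
      simp only [f, Submodule.mapQ_apply, LinearMap.mulLeft_apply, Submodule.mkQ_apply]
      rw [Submodule.Quotient.eq]
      have : a ^ n * v - (u * x + v * a ^ n) = -u * x := by ring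
      rw [this]
      exact N.mul_mem_left _ hx
    calc Module.length R (Submodule.map N.mkQ (Ideal.span {x, a ^ n}))
        ≤ Module.length R (LinearMap.range f) :=
          Module.length_le_of_injective (Submodule.inclusion hr) (Submodule.inclusion_injective hr)
      _ ≤ _ := Module.length_le_of_surjective f.rangeRestrict f.surjective_rangeRestrict

end Colength

/-! ### Squeezing the number of generators of the powers of `I` -/

section MinimalMultiplicity

variable {R : Type*} [CommRing R] [IsLocalRing R]

theorem colength_maximalIdeal : colength (maximalIdeal R) = 1 := by
  rw [colength, Module.length_eq_one_iff]
  exact isSimpleModule_iff_isCoatom.mpr (Ideal.isMaximal_def.mp inferInstance)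

/-- By Nakayama, μ(I) is the dimension of I/𝔪I over the residue field, which is also its length over
`R`. -/
theorem colength_maximalIdeal_mul {I : Ideal R} (hI : I.FG) :
    colength (maximalIdeal R * I) = I.spanFinrank + colength I := by
  have h1 := colength_eq_map_add (Ideal.mul_le_right : maximalIdeal R * I ≤ I)
  rw [h1]
  congr 1
  let f : I →ₗ[R] R ⧸ (maximalIdeal R * I) := (maximalIdeal R * I).mkQ ∘ₗ I.subtype
  have hr : LinearMap.range f = Submodule.map (maximalIdeal R * I).mkQ I := by
    rw [LinearMap.range_comp, Submodule.range_subtype]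
  have hker : LinearMap.ker f = maximalIdeal R • (⊤ : Submodule R I) := by
    apply Submodule.map_injective_of_injective I.subtype_injective
    rw [Submodule.map_smul'', Submodule.map_top, Submodule.range_subtype, smul_eq_mul]
    ext z
    constructor
    · rintro ⟨y, hy, rfl⟩
      exact (mkQ_eq_zero_iff _ _).mp hy
    · intro hz
      exact ⟨⟨z, Ideal.mul_le_right hz⟩, (mkQ_eq_zero_iff _ _).mpr hz, rfl⟩
  rw [← hr, length_range_eq, hker, IsLocalRing.spanFinrank_eq_finrank_quotient I hI]
  rw [Module.length_eq_of_surjective (R := R ⧸ maximalIdeal R) Ideal.Quotient.mk_surjective]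
  let : Field (R ⧸ maximalIdeal R) := Ideal.Quotient.field _
  have : Module.Finite R I := Module.Finite.iff_fg.mpr hI
  have : Module.Finite (R ⧸ maximalIdeal R) (I ⧸ maximalIdeal R • (⊤ : Submodule R I)) :=
    Module.Finite.of_restrictScalars_finite R _ _
  exact Module.length_eq_finrank _ _

/-- The right side is ℓ(R/(xI + b𝔪)), by the Koszul count with K = R, and xI + b𝔪 ⊆ 𝔪I. It serves to
bound μ(Iⁿ) through the pair (x, aⁿ). -/
theorem colength_maximalIdeal_mul_le {I : Ideal R} {x b : R} (hk : KoszulExact x b)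
    (hx : x ∈ maximalIdeal R) (hb : b ∈ I) :
    colength (maximalIdeal R * I) ≤ colength I + 1 + colength (Ideal.span {x, b}) := by
  have h := colength_koszul hk (A := I) (B := maximalIdeal R) (K := ⊤) (fun w => by
    exact iff_of_true Submodule.mem_top ⟨I.mul_mem_right w hb, Ideal.mul_mem_right w _ hx⟩)
  have h0 : colength (⊤ : Ideal R) = 0 := Module.length_eq_zero
  rw [h0, zero_add, colength_maximalIdeal] at h
  rw [h]
  apply colength_mono
  refine sup_le (Ideal.mul_mono_left ?_) ?_
  · rwa [Ideal.span_singleton_le_iff_mem]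
  · rw [mul_comm]
    exact Ideal.mul_mono_right (by rwa [Ideal.span_singleton_le_iff_mem])

/-- The inclusion xI + a𝔪 ⊆ 𝔪I always holds; the bound on μ(I) leaves no room for it to be strict.
-/
theorem maximalIdeal_mul_eq {I : Ideal R} {x a : R} (hFG : I.FG) (hk : KoszulExact x a)
    (hx : x ∈ maximalIdeal R) (ha : a ∈ I) (hI : colength I ≠ ⊤)
    (hμ : colength (Ideal.span {x, a}) + 1 ≤ I.spanFinrank) :
    maximalIdeal R * I = Ideal.span {x} * I ⊔ Ideal.span {a} * maximalIdeal R := by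
  have h := colength_koszul hk (A := I) (B := maximalIdeal R) (K := ⊤) (fun w => by
    exact iff_of_true Submodule.mem_top ⟨I.mul_mem_right w ha, Ideal.mul_mem_right w _ hx⟩)
  have h0 : colength (⊤ : Ideal R) = 0 := Module.length_eq_zero
  rw [h0, zero_add, colength_maximalIdeal] at h
  have hle : Ideal.span {x} * I ⊔ Ideal.span {a} * maximalIdeal R ≤ maximalIdeal R * I := by
    refine sup_le (Ideal.mul_mono_left ?_) ?_
    · rwa [Ideal.span_singleton_le_iff_mem]
    · rw [mul_comm]
      exact Ideal.mul_mono_right (by rwa [Ideal.span_singleton_le_iff_mem])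
  refine (eq_of_colength_le hle ?_ ?_).symm
  · rw [colength_maximalIdeal_mul hFG]
    exact WithTop.add_ne_top.mpr ⟨ENat.natCast_ne_top _, hI⟩
  · rw [← h, colength_maximalIdeal_mul hFG, add_assoc, add_comm 1, add_comm]
    gcongr

theorem mem_pow_of_mul_mem_pow_succ [IsNoetherianRing R] {I : Ideal R} {x a : R}
    (hk : KoszulExact x a) (hx : x ∈ maximalIdeal R) (ha : a ∈ I)
    (hrad : maximalIdeal R ≤ I.radical) (hfin : ∀ n, colength (I ^ n) ≠ ⊤)
    (hε : colength (Ideal.span {x, a}) ≠ ⊤)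
    (hμ : colength (Ideal.span {x, a}) + 1 ≤ I.spanFinrank)
    (hreg : ∀ n, ∀ y ∈ I ^ n, a * y ∈ maximalIdeal R * I ^ (n + 1) → y ∈ maximalIdeal R * I ^ n)
    (n : ℕ) (y : R) (hy : a * y ∈ I ^ (n + 1)) : y ∈ I ^ n := by
  have hmI := maximalIdeal_mul_eq I.fg_of_isNoetherianRing hk hx ha (by simpa using hfin 1) hμ
  set ε := colength (Ideal.span {x, a})
  have haI (n : ℕ) : Ideal.span {a} * I ^ n ≤ I ^ (n + 1) := by
    rw [pow_succ']
    exact Ideal.mul_mono_left (by rwa [Ideal.span_singleton_le_iff_mem])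
  have hQ (n : ℕ) : Ideal.span {a} * I ^ n ⊔ maximalIdeal R * I ^ (n + 1) =
      Ideal.span {x} * I ^ (n + 1) ⊔ Ideal.span {a} * I ^ n := by
    apply le_antisymm
    · refine sup_le le_sup_right ?_
      rw [pow_succ', ← mul_assoc, hmI, Ideal.sup_mul]
      refine sup_le (le_sup_of_le_left (mul_assoc _ _ _).le) (le_sup_of_le_right ?_)
      rw [mul_assoc]
      exact Ideal.mul_mono_right Ideal.mul_le_right
    · refine sup_le (le_sup_of_le_right (Ideal.mul_mono_left ?_)) le_sup_left
      rwa [Ideal.span_singleton_le_iff_mem]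
  let K (n : ℕ) : Ideal R :=
    Submodule.comap (LinearMap.mulLeft R a) (I ^ (n + 1)) ⊓
      Submodule.comap (LinearMap.mulLeft R x) (I ^ n)
  have hKle (n : ℕ) : I ^ n ≤ K n := fun z hz =>
    ⟨haI n (Ideal.mul_mem_mul (Ideal.mem_span_singleton_self a) hz), Ideal.mul_mem_left _ _ hz⟩
  have hG (n : ℕ) : colength (maximalIdeal R * I ^ n) =
      (I ^ n).spanFinrank + colength (I ^ n) :=
    colength_maximalIdeal_mul (Ideal.fg_of_isNoetherianRing _)
  have hub (n : ℕ) : ((I ^ n).spanFinrank : ℕ∞) ≤ 1 + n * ε := by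
    have h := colength_maximalIdeal_mul_le (hk.pow n) hx (Ideal.pow_mem_pow ha n)
    rw [hG, add_assoc, add_comm] at h
    exact ((ENat.add_le_add_iff_left (hfin n)).mp h).trans
      (add_le_add le_rfl (colength_span_pair_pow_le x a n))
  -- Two counts share the term ℓ(R/(xIⁿ⁺¹ + aIⁿ)): one from the injection of Iⁿ/𝔪Iⁿ into Iⁿ⁺¹/𝔪Iⁿ⁺¹
  -- by `a`, one from the Koszul complex. Eliminating it gives the recursion.
  have hrec (n : ℕ) : ((I ^ n).spanFinrank : ℕ∞) + ε + colength (I ^ n) =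
      (I ^ (n + 1)).spanFinrank + colength (K n) := by
    have h1 := colength_mul_sup (c := a) (N := maximalIdeal R * I ^ n) (P := I ^ n)
      (N' := maximalIdeal R * I ^ (n + 1)) Ideal.mul_le_right (fun z hz =>
        ⟨hreg n z hz, fun hz' => by
          rw [pow_succ', mul_left_comm]
          exact Ideal.mul_mem_mul ha hz'⟩)
    have h2 := colength_koszul hk (A := I ^ (n + 1)) (B := I ^ n) (K := K n) (fun w => Iff.rfl)
    rw [hQ, hG, hG] at h1
    generalize colength (Ideal.span {x} * I ^ (n + 1) ⊔ Ideal.span {a} * I ^ n) = q at h1 h2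
    have hKf : colength (K n) ≠ ⊤ := ne_top_of_le_ne_top (hfin n) (colength_mono (hKle n))
    have h3 := hfin n
    have h4 := hfin (n + 1)
    change colength (I ^ (n + 1)) + colength (I ^ n) + ε = _ at h2
    generalize colength (I ^ n) = p at *
    generalize colength (I ^ (n + 1)) = p' at *
    generalize colength (K n) = k at *
    have hqf : q ≠ ⊤ := by
      intro hq
      rw [hq, add_top] at h2
      simp [h3, h4, hε] at h2
    lift p to ℕ using h3
    lift p' to ℕ using h4
    lift k to ℕ using hKf
    lift q to ℕ using hqf
    clear_value ε
    lift ε to ℕ using hε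
    norm_cast at *
    omega
  have hlb (n : ℕ) : 1 + n * ε ≤ ((I ^ n).spanFinrank : ℕ∞) := by
    induction n with
    | zero =>
      have : (I ^ 0).spanFinrank = 1 := by
        rw [pow_zero, Ideal.one_eq_top, ← Ideal.span_singleton_one]
        exact Submodule.spanFinrank_singleton one_ne_zero
      rw [this]
      simp
    | succ n ih =>
      have h1 : ((I ^ n).spanFinrank : ℕ∞) + ε + colength (I ^ n) ≤
          (I ^ (n + 1)).spanFinrank + colength (I ^ n) := by
        rw [hrec]
        exact add_le_add le_rfl (colength_mono (hKle n))
      rw [ENat.add_le_add_iff_right (hfin n)] at h1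
      refine le_trans ?_ h1
      rw [Nat.cast_add, add_mul, Nat.cast_one, one_mul, ← add_assoc]
      exact add_le_add ih le_rfl
  have hKeq (n : ℕ) : I ^ n = K n := by
    refine eq_of_colength_le (hKle n)
      (ne_top_of_le_ne_top (hfin n) (colength_mono (hKle n))) ?_
    have h := hrec n
    have e1 := le_antisymm (hub n) (hlb n)
    have e2 := le_antisymm (hub (n + 1)) (hlb (n + 1))
    rw [e2, Nat.cast_add, add_mul, Nat.cast_one, one_mul, ← add_assoc, ← e1] at h
    exact (WithTop.add_left_cancel (WithTop.add_ne_top.mpr ⟨ENat.natCast_ne_top _, hε⟩) h).le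
  -- A high power of `x` carries `y` into Iⁿ; the factors `x` are then stripped one at a time, each
  -- by Kₙ = Iⁿ.
  obtain ⟨k, hxk⟩ := hrad hx
  have hxy : ∀ j, x ^ j * y ∈ I ^ n → y ∈ I ^ n := by
    intro j
    induction j with
    | zero => simp
    | succ j ih =>
      intro h
      refine ih ?_
      rw [hKeq n]
      refine ⟨?_, ?_⟩
      · change a * (x ^ j * y) ∈ I ^ (n + 1)
        rw [mul_left_comm]
        exact Ideal.mul_mem_left _ _ hy
      · change x * (x ^ j * y) ∈ I ^ n
        rwa [← mul_assoc, ← pow_succ']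
  exact hxy (k * n) (Ideal.mul_mem_right _ _ (by rw [pow_mul]; exact Ideal.pow_mem_pow hxk n))

end MinimalMultiplicity

/-! ### Regularity in blowup rings in terms of ideals of `R` -/

section Rees

variable {R : Type*} [CommRing R]

/-- The element `y t ^ n` of the Rees algebra. -/
def reesMonomial (I : Ideal R) (n : ℕ) (y : R) (hy : y ∈ I ^ n) : reesAlgebra I :=
  ⟨Polynomial.monomial n y, reesAlgebra.monomial_mem.mpr hy⟩

theorem reesMonomial_mul {I : Ideal R} {n k : ℕ} {y z : R} (hy : y ∈ I ^ n) (hz : z ∈ I ^ k) :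
    reesMonomial I n y hy * reesMonomial I k z hz =
      reesMonomial I (n + k) (y * z) (by rw [pow_add]; exact Ideal.mul_mem_mul hy hz) :=
  Subtype.ext (Polynomial.monomial_mul_monomial n k y z)

theorem reesMonomial_mem_map {I J : Ideal R} {n : ℕ} {y : R} (h : y ∈ J * I ^ n) :
    reesMonomial I n y (Ideal.mul_le_right h) ∈ J.map (algebraMap R (reesAlgebra I)) := by
  suffices H : ∀ hy : y ∈ I ^ n, reesMonomial I n y hy ∈ J.map (algebraMap R (reesAlgebra I)) from
    H _
  induction h using Submodule.mul_induction_on' with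
  | mem_mul_mem j hj i hi =>
    intro hy
    have : reesMonomial I n (j * i) hy = algebraMap R (reesAlgebra I) j * reesMonomial I n i hi :=
      Subtype.ext (by
        change Polynomial.monomial n (j * i) = Polynomial.C j * Polynomial.monomial n i
        rw [Polynomial.C_mul_monomial])
    rw [this]
    exact Ideal.mul_mem_right _ _ (Ideal.mem_map_of_mem _ hj)
  | add a ha b hb iha ihb =>
    intro hy
    have : reesMonomial I n (a + b) hy = reesMonomial I n a (Ideal.mul_le_right ha) +
        reesMonomial I n b (Ideal.mul_le_right hb) := Subtype.ext (map_add _ _ _)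
    rw [this]
    exact Ideal.add_mem _ (iha _) (ihb _)

/-- The extension of `J` is the graded ideal ⨁ J Iⁿ tⁿ, so questions about F(I) and G(I) can be
settled one degree at a time. -/
theorem mem_map_algebraMap_reesAlgebra_iff {I J : Ideal R} {f : reesAlgebra I} :
    f ∈ J.map (algebraMap R (reesAlgebra I)) ↔
      ∀ n, (f : Polynomial R).coeff n ∈ J * I ^ n := by
  constructor
  · intro h
    induction h using Submodule.span_induction with
    | mem f hf =>
      obtain ⟨j, hj, rfl⟩ := hf
      intro n
      change (Polynomial.C j).coeff n ∈ _
      rw [Polynomial.coeff_C]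
      split_ifs with hn
      · simpa [hn] using hj
      · exact Ideal.zero_mem _
    | zero => simp
    | add f g _ _ hf hg =>
      intro n
      simpa using Ideal.add_mem _ (hf n) (hg n)
    | smul f g _ hg =>
      intro n
      change ((f : Polynomial R) * g).coeff n ∈ _
      rw [Polynomial.coeff_mul]
      refine Ideal.sum_mem _ fun p hp => ?_
      rw [← Finset.HasAntidiagonal.mem_antidiagonal.mp hp, pow_add, mul_left_comm]
      exact Ideal.mul_mem_mul (f.2 _) (hg _)
  · intro h
    have : f = ∑ n ∈ (f : Polynomial R).support,
        reesMonomial I n ((f : Polynomial R).coeff n) (f.2 n) := by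
      apply Subtype.ext
      rw [AddSubmonoidClass.coe_finsetSum]
      exact (f : Polynomial R).as_sum_support
    rw [this]
    exact Ideal.sum_mem _ fun n _ => reesMonomial_mem_map (h n)

theorem reesMonomial_mem_map_iff {I J : Ideal R} {n : ℕ} {y : R} (hy : y ∈ I ^ n) :
    reesMonomial I n y hy ∈ J.map (algebraMap R (reesAlgebra I)) ↔ y ∈ J * I ^ n := by
  refine ⟨fun h => ?_, fun h => reesMonomial_mem_map h⟩
  simpa [reesMonomial] using mem_map_algebraMap_reesAlgebra_iff.mp h n

theorem degreeOne_eq (I J : Ideal R) (a : I) :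
    degreeOne I J a = Ideal.Quotient.mk _ (reesMonomial I 1 a (by simp)) := rfl

theorem mem_of_isRegular_degreeOne {I J : Ideal R} {a : I} (h : IsRegular (degreeOne I J a))
    (n : ℕ) (y : R) (hy : y ∈ I ^ n) (hay : (a : R) * y ∈ J * I ^ (n + 1)) : y ∈ J * I ^ n := by
  rw [← reesMonomial_mem_map_iff hy, ← Ideal.Quotient.eq_zero_iff_mem]
  apply h.left
  simp only
  rw [mul_zero, degreeOne_eq, ← map_mul, Ideal.Quotient.eq_zero_iff_mem, reesMonomial_mul,
    reesMonomial_mem_map_iff, add_comm]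
  exact hay

theorem isRegular_degreeOne {I J : Ideal R} {a : I}
    (h : ∀ n, ∀ y ∈ I ^ n, (a : R) * y ∈ J * I ^ (n + 1) → y ∈ J * I ^ n) :
    IsRegular (degreeOne I J a) := by
  suffices H : ∀ f, degreeOne I J a * f = 0 → f = 0 from
    have L : IsLeftRegular (degreeOne I J a) := fun f g hfg =>
      sub_eq_zero.mp (H _ ((mul_sub _ _ _).trans (sub_eq_zero.mpr hfg)))
    ⟨L, fun f g hfg => L (show degreeOne I J a * f = degreeOne I J a * g from
      ((mul_comm _ f).trans hfg).trans (mul_comm g _))⟩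
  intro f hf
  obtain ⟨f, rfl⟩ := Ideal.Quotient.mk_surjective f
  rw [degreeOne_eq, ← map_mul, Ideal.Quotient.eq_zero_iff_mem,
    mem_map_algebraMap_reesAlgebra_iff] at hf
  rw [Ideal.Quotient.eq_zero_iff_mem, mem_map_algebraMap_reesAlgebra_iff]
  intro n
  refine h n _ (f.2 n) ?_
  have h1 := hf (n + 1)
  change (Polynomial.monomial 1 (a : R) * (f : Polynomial R)).coeff (n + 1) ∈ _ at h1
  rwa [Polynomial.coeff_monomial_mul] at h1

end Rees

/-! ### Koszul exactness from a regular sequence -/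

section Koszul

variable {R : Type*} [CommRing R]

/-- Depth sensitivity by hand: a syzygy (u,v) of (x,a) satisfies yu = aw and zu = aw' with zw = yw'.
Regularity of `z` modulo `y` gives w = yt, and cancelling `y` leaves u = at. -/
theorem koszulExact_of_mem_span_pair {x a y z : R} (hy : ∀ w, y * w = 0 → w = 0)
    (hz : ∀ w t, z * w = y * t → ∃ s, w = y * s) (hyxa : y ∈ Ideal.span {x, a})
    (hzxa : z ∈ Ideal.span {x, a}) : KoszulExact x a := by
  intro u v huv
  obtain ⟨α, β, rfl⟩ := Ideal.mem_span_pair.mp hyxa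
  obtain ⟨γ, δ, rfl⟩ := Ideal.mem_span_pair.mp hzxa
  set y := α * x + β * a with hyd
  set z := γ * x + δ * a with hzd
  set w := β * u - α * v with hw
  set w' := δ * u - γ * v with hw'
  have e1 : y * u = a * w := by rw [hyd, hw]; linear_combination α * huv
  have e2 : y * v = -(x * w) := by rw [hyd, hw]; linear_combination β * huv
  have e3 : z * u = a * w' := by rw [hzd, hw']; linear_combination γ * huv
  have e4 : z * v = -(x * w') := by rw [hzd, hw']; linear_combination δ * huv
  have e5 : z * w = y * w' := by rw [hw, hw']; linear_combination β * e3 - α * e4 - w' * hyd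
  obtain ⟨t, ht⟩ := hz w w' e5
  refine ⟨t, ?_, ?_⟩
  · exact sub_eq_zero.mp (hy _ (by rw [ht] at e1; linear_combination e1))
  · exact sub_eq_zero.mp (hy _ (by rw [ht] at e2; linear_combination e2))

theorem regular_pair_pow {y z : R} (hy : ∀ w, y * w = 0 → w = 0)
    (hz : ∀ w t, z * w = y * t → ∃ s, w = y * s) (k : ℕ) :
    (∀ w, y ^ k * w = 0 → w = 0) ∧
      ∀ w t, z ^ k * w = y ^ k * t → ∃ s, w = y ^ k * s := by
  have h1 : ∀ k w, y ^ k * w = 0 → w = 0 := by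
    intro k
    induction k with
    | zero => simp
    | succ k ih => exact fun w h => ih w (hy _ (by rw [← h]; ring))
  have h2 : ∀ k w t, z ^ k * w = y * t → ∃ s, w = y * s := by
    intro k
    induction k with
    | zero => exact fun w t h => ⟨t, by simpa using h⟩
    | succ k ih =>
      intro w t h
      obtain ⟨s, hs⟩ := ih (z * w) t (by rw [← h]; ring)
      exact hz w s hs
  refine ⟨h1 k, ?_⟩
  suffices H : ∀ j w t, z ^ k * w = y ^ j * t → ∃ s, w = y ^ j * s from H k
  intro j
  induction j with
  | zero => exact fun w t _ => ⟨w, by simp⟩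
  | succ j ih =>
    intro w t h
    obtain ⟨s, rfl⟩ := h2 k w (y ^ j * t) (by rw [h]; ring)
    obtain ⟨s', hs'⟩ := ih s t (sub_eq_zero.mp (hy _ (by linear_combination h)))
    exact ⟨s', by rw [hs']; ring⟩

theorem exists_regular_pair_of_one_lt_idealGrade {J : Ideal R} (h : 1 < idealGrade J) :
    ∃ y ∈ J, ∃ z ∈ J, (∀ w, y * w = 0 → w = 0) ∧
      ∀ w t, z * w = y * t → ∃ s, w = y * s := by
  rw [idealGrade, lt_iSup_iff] at h
  obtain ⟨rs, h⟩ := h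
  rw [lt_iSup_iff] at h
  obtain ⟨⟨hreg, hmem⟩, h⟩ := h
  match rs, hreg, hmem, h with
  | [], _, _, h => simp at h
  | [y], _, _, h => simp at h
  | y :: z :: rs, hreg, hmem, _ =>
    rw [RingTheory.Sequence.isRegular_cons_iff, RingTheory.Sequence.isRegular_cons_iff] at hreg
    obtain ⟨h1, h2, -⟩ := hreg
    refine ⟨y, hmem y (by simp), z, hmem z (by simp), fun w hw => ?_, fun w t hwt => ?_⟩
    · exact h1 (by simpa using hw)
    · have hmem' (r : R) : (Submodule.Quotient.mk r : QuotSMulTop y R) = 0 ↔ ∃ s, r = y * s := by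
        rw [Submodule.Quotient.mk_eq_zero, Submodule.mem_smul_pointwise_iff_exists]
        simp [eq_comm]
      rw [← hmem']
      apply h2
      change z • (Submodule.Quotient.mk w : QuotSMulTop y R) = z • 0
      rw [smul_zero, ← Submodule.Quotient.mk_smul, hmem']
      exact ⟨t, hwt⟩

end Koszul

/-! ### The Bhattacharya polynomial in dimension two -/

section Polynomial

variable {R : Type*} [CommRing R]

theorem IsBhattacharyaPolynomial.exists_colength {J I : Ideal R} {e : ℕ → ℕ → ℤ}
    (h : IsBhattacharyaPolynomial 2 J I e) :
    ∃ (N : ℕ) (H : ℕ → ℕ → ℕ), ∀ r ≥ N, ∀ s ≥ N, colength (J ^ r * I ^ s) = H r s ∧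
      (H r s : ℤ) = e 0 0 + e 0 1 * (s + 1) + e 0 2 * ((s + 2).choose 2 : ℕ) + e 1 0 * (r + 1) +
        e 1 1 * (r + 1) * (s + 1) + e 2 0 * ((r + 2).choose 2 : ℕ) := by
  obtain ⟨N, hN⟩ := h
  choose! H hH using hN
  refine ⟨N, H, fun r hr s hs => ⟨(hH r hr s hs).1, ?_⟩⟩
  rw [(hH r hr s hs).2]
  simp [Finset.sum_range_succ]
  ring

variable [IsLocalRing R]

theorem HasMinimalMixedMultiplicity.exists_isBhattacharyaPolynomial [IsNoetherianRing R]
    (hdim : ringKrullDim R = 2) {I : Ideal R} (hI : I.radical = maximalIdeal R)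
    (h : HasMinimalMixedMultiplicity I) :
    ∃ e, IsBhattacharyaPolynomial 2 (maximalIdeal R) I e ∧ (I.spanFinrank : ℤ) = e 1 1 + 1 := by
  obtain ⟨k, hk, hμ⟩ := h
  have hk1 : k = 1 := by
    rw [hdim] at hk
    have : (2 : ℕ) = k + 1 := by exact_mod_cast hk
    omega
  subst hk1
  rw [mixedMultiplicity] at hμ
  split_ifs at hμ with hex
  · exact ⟨hex.choose, hex.choose_spec, by exact_mod_cast hμ⟩
  -- Without a polynomial the multiplicity defaults to 0, so `I` would be principal, against Krull's
  -- height theorem in dimension two.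
  · exfalso
    have h1 : I.spanFinrank = 1 := by exact_mod_cast hμ
    have hp : I.IsPrincipal := ((Submodule.spanFinrank_eq_one_iff I).mp h1).1
    have hmin : maximalIdeal R ∈ I.minimalPrimes := by
      rw [← Ideal.radical_minimalPrimes, hI, Ideal.minimalPrimes_eq_subsingleton_self]
      rfl
    have h2 := Ideal.height_le_one_of_isPrincipal_of_mem_minimalPrimes I _ hmin
    have h3 := IsLocalRing.maximalIdeal_height_eq_ringKrullDim (R := R)
    rw [hdim] at h3
    have h4 : (maximalIdeal R).height = 2 := WithBot.coe_injective h3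
    rw [h4] at h2
    exact absurd h2 (by decide)

end Polynomial

/-! ### From joint reductions to regularity in `G(I)` -/

section MinimalMixedMultiplicity

variable {R : Type*} [CommRing R]

theorem IsCohenMacaulayLocal.koszulExact [IsLocalRing R] (hCM : IsCohenMacaulayLocal R)
    (hdim : ringKrullDim R = 2) {x a : R} (h : maximalIdeal R ≤ (Ideal.span {x, a}).radical) :
    KoszulExact x a := by
  have hg : idealGrade (maximalIdeal R) = 2 := WithBot.coe_injective (hCM.2.trans hdim)
  obtain ⟨y, hy, z, hz, h1, h2⟩ :=
    exists_regular_pair_of_one_lt_idealGrade (J := maximalIdeal R) (by rw [hg]; decide)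
  obtain ⟨k, hk⟩ := h hy
  obtain ⟨l, hl⟩ := h hz
  obtain ⟨h3, h4⟩ := regular_pair_pow h1 h2 (k + l)
  exact koszulExact_of_mem_span_pair h3 h4 (by rw [pow_add]; exact Ideal.mul_mem_right _ _ hk)
    (by rw [pow_add]; exact Ideal.mul_mem_left _ _ hl)

theorem IsBhattacharyaPolynomial.colength_pow_ne_top {J I : Ideal R} {e : ℕ → ℕ → ℤ}
    (h : IsBhattacharyaPolynomial 2 J I e) (n : ℕ) : colength (I ^ n) ≠ ⊤ := by
  obtain ⟨N, H, hH⟩ := h.exists_colength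
  refine ne_top_of_le_ne_top ?_
    (colength_mono (Ideal.mul_le_right.trans (Ideal.pow_le_pow_right (Nat.le_add_left n N)) :
      J ^ N * I ^ (N + n) ≤ I ^ n))
  rw [(hH N le_rfl (N + n) (Nat.le_add_right _ _)).1]
  exact ENat.natCast_ne_top _

/-- The Koszul count expresses ε through lengths, with K ⊇ Jʳ Iˢ; replacing K by Jʳ Iˢ gives the
mixed difference of the polynomial, which is e₁₁. `N` is chosen before `x` and `a`, so a pair can
later be built to fit it. -/
theorem IsBhattacharyaPolynomial.colength_span_pair_le {J I : Ideal R} {e : ℕ → ℕ → ℤ}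
    (h : IsBhattacharyaPolynomial 2 J I e) :
    ∃ N, ∀ x ∈ J, ∀ a ∈ I, ∀ r ≥ N, ∀ s ≥ N, KoszulExact x a → J ^ (r + 1) * I ^ (s + 1) =
      Ideal.span {x} * (J ^ r * I ^ (s + 1)) ⊔ Ideal.span {a} * (J ^ (r + 1) * I ^ s) →
    ∃ ε : ℕ, colength (Ideal.span {x, a}) = ε ∧ (ε : ℤ) ≤ e 1 1 := by
  obtain ⟨N, H, hH⟩ := h.exists_colength
  refine ⟨N, fun x hx a ha r hr s hs hk hrs => ?_⟩
  let K : Ideal R := Submodule.comap (LinearMap.mulLeft R a) (J ^ r * I ^ (s + 1)) ⊓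
      Submodule.comap (LinearMap.mulLeft R x) (J ^ (r + 1) * I ^ s)
  have hK : J ^ r * I ^ s ≤ K := fun z hz => by
    refine ⟨?_, ?_⟩
    · change a * z ∈ J ^ r * I ^ (s + 1)
      rw [pow_succ' I, mul_left_comm]
      exact Ideal.mul_mem_mul ha hz
    · change x * z ∈ J ^ (r + 1) * I ^ s
      rw [pow_succ' J, mul_assoc]
      exact Ideal.mul_mem_mul hx hz
  have h1 := colength_koszul hk (A := J ^ r * I ^ (s + 1)) (B := J ^ (r + 1) * I ^ s) (K := K)
    (fun w => Iff.rfl)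
  have h2 := colength_mono hK
  obtain ⟨a1, b1⟩ := hH r hr s hs
  obtain ⟨a2, b2⟩ := hH (r + 1) (by omega) s hs
  obtain ⟨a3, b3⟩ := hH r hr (s + 1) (by omega)
  obtain ⟨a4, b4⟩ := hH (r + 1) (by omega) (s + 1) (by omega)
  rw [← hrs, a2, a3, a4] at h1
  rw [a1] at h2
  have h3 : colength (Ideal.span {x, a}) ≠ ⊤ := by
    intro htop
    rw [htop, add_top] at h1
    have := ne_top_of_le_ne_top (ENat.natCast_ne_top _) h2
    exact WithTop.add_ne_top.mpr ⟨this, ENat.natCast_ne_top (H (r + 1) (s + 1))⟩ h1.symm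
  obtain ⟨ε, hε⟩ := ENat.ne_top_iff_exists.mp h3
  obtain ⟨k, hk⟩ := ENat.ne_top_iff_exists.mp (ne_top_of_le_ne_top (ENat.natCast_ne_top _) h2)
  refine ⟨ε, hε.symm, ?_⟩
  rw [← hε, ← hk] at h1
  rw [← hk] at h2
  have h1' : H r (s + 1) + H (r + 1) s + ε = k + H (r + 1) (s + 1) := by exact_mod_cast h1
  have h2' : k ≤ H r s := by exact_mod_cast h2
  zify at h1' h2'
  rw [b2, b3, b4] at h1'
  rw [b1] at h2'
  push_cast at h1' h2'
  linarith

theorem isRegular_degreeOne_assocGraded [IsLocalRing R] (hCM : IsCohenMacaulayLocal R)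
    (hdim : ringKrullDim R = 2) {I : Ideal R} (hI : I.radical = maximalIdeal R)
    {e : ℕ → ℕ → ℤ} (he : IsBhattacharyaPolynomial 2 (maximalIdeal R) I e)
    (hμ : (I.spanFinrank : ℤ) = e 1 1 + 1) :
    ∃ N, ∀ x ∈ maximalIdeal R, ∀ a : I, ∀ r ≥ N, ∀ s ≥ N, maximalIdeal R ^ (r + 1) * I ^ (s + 1) =
      Ideal.span {x} * (maximalIdeal R ^ r * I ^ (s + 1)) ⊔
        Ideal.span {(a : R)} * (maximalIdeal R ^ (r + 1) * I ^ s) →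
      IsRegular (degreeOne I (maximalIdeal R) a : FiberCone I) →
    IsRegular (degreeOne I I a : AssocGraded I) := by
  have := hCM.1
  obtain ⟨N, hN⟩ := he.colength_span_pair_le
  refine ⟨N, fun x hx a r hr s hs hrs hreg => ?_⟩
  have hrad : maximalIdeal R ≤ (Ideal.span {x, (a : R)}).radical := by
    intro y hy
    obtain ⟨k, hk⟩ : y ∈ I.radical := by rwa [hI]
    refine ⟨(r + 1) + k * (s + 1), ?_⟩
    have h1 : y ^ (r + 1 + k * (s + 1)) ∈ maximalIdeal R ^ (r + 1) * I ^ (s + 1) := by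
      rw [pow_add y, pow_mul y]
      exact Ideal.mul_mem_mul (Ideal.pow_mem_pow hy _) (Ideal.pow_mem_pow hk _)
    rw [hrs] at h1
    refine (sup_le ?_ ?_ : _ ≤ Ideal.span {x, (a : R)}) h1
    · exact Ideal.mul_le_left.trans (Ideal.span_mono (by simp : ({x} : Set R) ⊆ {x, (a : R)}))
    · exact Ideal.mul_le_left.trans (Ideal.span_mono (by simp : ({(a : R)} : Set R) ⊆ {x, (a : R)}))
  have hk := hCM.koszulExact hdim hrad
  obtain ⟨ε, hε, hle⟩ := hN x hx a a.2 r hr s hs hk hrs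
  refine isRegular_degreeOne fun n y _ hay => ?_
  rw [← pow_succ']
  -- The degree `n` part of G(I) is Iⁿ/Iⁿ⁺¹, so the colon identity is used with exponent n + 1.
  refine mem_pow_of_mul_mem_pow_succ hk hx a.2 hI.ge he.colength_pow_ne_top
    (by rw [hε]; exact ENat.natCast_ne_top _) ?_ (mem_of_isRegular_degreeOne hreg) (n + 1) y
    (by rwa [← pow_succ'] at hay)
  rw [hε]
  have : ε + 1 ≤ I.spanFinrank := by omega
  exact_mod_cast this

theorem IsJointReduction.pow_mul_pow_eq {J I : Ideal R} {x a : R}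
    (h : IsJointReduction ![J, I] ![x, a]) :
    x ∈ J ∧ a ∈ I ∧ ∃ n, ∀ r ≥ n, ∀ s ≥ n, J ^ (r + 1) * I ^ (s + 1) =
      Ideal.span {x} * (J ^ r * I ^ (s + 1)) ⊔ Ideal.span {a} * (J ^ (r + 1) * I ^ s) := by
  obtain ⟨hmem, n, hn⟩ := h
  refine ⟨by simpa using hmem 0, by simpa using hmem 1, n, fun r hr s hs => ?_⟩
  have e0 : (Finset.univ.erase (0 : Fin 2)) = {1} := by decide
  have e1 : (Finset.univ.erase (1 : Fin 2)) = {0} := by decide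
  simp only [Fin.sum_univ_two, Fin.prod_univ_two, e0, e1, Finset.prod_singleton,
    Matrix.cons_val_zero, Matrix.cons_val_one] at hn
  obtain ⟨r, rfl⟩ := Nat.exists_eq_add_of_le hr
  obtain ⟨s, rfl⟩ := Nat.exists_eq_add_of_le hs
  calc J ^ (n + r + 1) * I ^ (n + s + 1) = (J * I) ^ (n + 1) * (J ^ r * I ^ s) := by ring
    _ = _ := by
      rw [← hn, ← Submodule.add_eq_sup]
      ring

end MinimalMixedMultiplicity

/-! ### Filter-regular elements over an infinite residue field -/

section FilterRegular

variable {R : Type*} [CommRing R] [IsLocalRing R]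

/-- For v ∉ N, lifts of distinct residues differ by a unit, so the corresponding multiples of `v`
lie in distinct cosets. -/
theorem not_finiteIndex_of_ne_top [Infinite (ResidueField R)] {V : Type*}
    [AddCommGroup V] [Module R V] {N : Submodule R V} (hN : N ≠ ⊤) : ¬ N.toAddSubgroup.FiniteIndex := by
  intro hfin
  have : Finite (V ⧸ N.toAddSubgroup) := AddSubgroup.finite_quotient_of_finiteIndex
  obtain ⟨v, hv⟩ : ∃ v, v ∉ N := by
    by_contra! h
    exact hN (eq_top_iff.mpr fun v _ => h v)
  let g : ResidueField R → V ⧸ N.toAddSubgroup := fun c =>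
    QuotientAddGroup.mk (Function.surjInv (residue_surjective (R := R)) c • v)
  have hg : Function.Injective g := by
    intro c d hcd
    by_contra hne
    have h1 := QuotientAddGroup.eq.mp hcd
    set c' := Function.surjInv (residue_surjective (R := R)) c with hc
    set d' := Function.surjInv (residue_surjective (R := R)) d with hd
    have hc' : residue R c' = c := Function.surjInv_eq _ _
    have hd' : residue R d' = d := Function.surjInv_eq _ _
    have h2 : (d' - c') • v ∈ N := by
      rw [sub_smul, sub_eq_neg_add]
      exact h1
    have h3 : IsUnit (d' - c') := by
      rw [← residue_ne_zero_iff_isUnit, map_sub, hc', hd', sub_ne_zero]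
      exact Ne.symm hne
    obtain ⟨u, hu⟩ := h3
    apply hv
    have := N.smul_mem (↑u⁻¹ : R) h2
    rwa [← hu, smul_smul, Units.inv_mul, one_smul] at this
  exact not_finite_iff_infinite.mpr ‹_› (Finite.of_injective g hg)

theorem exists_notMem_of_finite [Infinite (ResidueField R)] {V : Type*}
    [AddCommGroup V] [Module R V] {s : Set (Submodule R V)} (hs : s.Finite)
    (hN : ∀ N ∈ s, N ≠ ⊤) :
    ∃ v, ∀ N ∈ s, v ∉ N := by
  by_contra! h
  obtain ⟨N, hNs, hfin⟩ := Submodule.exists_finiteIndex_of_cover (p := fun N : Submodule R V => N)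
    (s := hs.toFinset) (Set.eq_univ_of_forall fun v => by
      obtain ⟨N, hNs, hv⟩ := h v
      simp only [Set.mem_iUnion]
      exact ⟨N, hs.mem_toFinset.mpr hNs, hv⟩)
  exact not_finiteIndex_of_ne_top (hN N (hs.mem_toFinset.mp hNs)) hfin

/-- Over a local ring with infinite residue field, a finitely generated module `M` over a
Noetherian algebra has a filter-regular element in the image of any linear map to the algebra. -/
theorem exists_filterRegular [Infinite (ResidueField R)] {A V : Type*} (M : Type*) [CommRing A]
    [IsNoetherianRing A] [Algebra R A] [AddCommGroup M] [Module A M] [Module.Finite A M]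
    [AddCommGroup V] [Module R V] (φ : V →ₗ[R] A) :
    ∃ (v : V) (n : ℕ), ∀ z ∈ (Ideal.span (Set.range φ) ^ n • ⊤ : Submodule A M),
      φ v • z = 0 → z = 0 := by
  let N (P : Ideal A) : Submodule R V := (P.restrictScalars R).comap φ
  obtain ⟨v, hv⟩ := exists_notMem_of_finite (V := V)
    (s := N '' {P ∈ associatedPrimes A M | N P ≠ ⊤})
    (((associatedPrimes.finite A M).subset (Set.sep_subset _ _)).image N) (by
      rintro _ ⟨P, ⟨-, hPt⟩, rfl⟩
      exact hPt)
  refine ⟨v, ?_⟩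
  let W := Ideal.span (Set.range φ)
  let K : Submodule A M := LinearMap.ker (LinearMap.lsmul A M (φ v))
  have hKmem (z : M) : z ∈ K ↔ φ v • z = 0 := by simp [K]
  -- Minimal primes over Ann K are associated primes of `M` containing φ(v); by the choice of `v`
  -- they contain the whole image of φ. So a power of W kills K, and Artin–Rees finishes.
  have hW : W ≤ (Module.annihilator A K).radical := by
    rw [← Ideal.sInf_minimalPrimes]
    refine le_sInf fun P hP => ?_
    have hPM : P ∈ associatedPrimes A M :=
      associatedPrimes.subset_of_injective K.subtype_injective
        (Module.associatedPrimes.minimalPrimes_annihilator_subset_associatedPrimes A K hP)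
    have hvP : φ v ∈ P := hP.1.2 (Module.mem_annihilator.mpr fun z =>
      Subtype.ext ((hKmem z).mp z.2))
    have hNP : N P = ⊤ := by
      by_contra hne
      exact hv _ ⟨P, ⟨hPM, hne⟩, rfl⟩ hvP
    rw [Ideal.span_le]
    rintro _ ⟨w, rfl⟩
    exact (hNP ▸ Submodule.mem_top : w ∈ N P)
  obtain ⟨c, hc⟩ := Ideal.exists_pow_le_of_le_radical_of_fg hW (Ideal.fg_of_isNoetherianRing _)
  obtain ⟨k, hk⟩ := W.exists_pow_inf_eq_pow_smul K
  refine ⟨k + c, fun z hz hvz => ?_⟩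
  have h1 : z ∈ W ^ (k + c) • ⊤ ⊓ K := ⟨hz, (hKmem z).mpr hvz⟩
  rw [hk _ (Nat.le_add_right _ _), Nat.add_sub_cancel_left] at h1
  refine Submodule.smul_induction_on h1 (fun r hr y hy => ?_) (fun y y' hy hy' => by simp [hy, hy'])
  have := Module.mem_annihilator.mp (hc hr) ⟨y, hy.2⟩
  simpa using congrArg Subtype.val this

/-- The module A/P × A/Q lets a single `v` serve both ideals. -/
theorem exists_filterRegular_quotient [Infinite (ResidueField R)] {A V : Type*} [CommRing A]
    [IsNoetherianRing A] [Algebra R A] [AddCommGroup V] [Module R V] (φ : V →ₗ[R] A)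
    (P Q : Ideal A) :
    ∃ (v : V) (n : ℕ), ∀ b ∈ Ideal.span (Set.range φ) ^ n,
      (φ v * b ∈ P → b ∈ P) ∧ (φ v * b ∈ Q → b ∈ Q) := by
  obtain ⟨v, n, h⟩ := exists_filterRegular ((A ⧸ P) × (A ⧸ Q)) φ
  refine ⟨v, n, fun b hb => ⟨fun hP => ?_, fun hQ => ?_⟩⟩
  · rw [← mkQ_eq_zero_iff] at hP ⊢
    have h1 := h (b • (P.mkQ 1, 0)) (Submodule.smul_mem_smul hb Submodule.mem_top) (by
      rw [smul_smul, Prod.smul_mk, smul_zero, ← map_smul, smul_eq_mul, mul_one, hP]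
      rfl)
    rw [Prod.smul_mk, ← map_smul, smul_eq_mul, mul_one] at h1
    exact congrArg Prod.fst h1
  · rw [← mkQ_eq_zero_iff] at hQ ⊢
    have h1 := h (b • (0, Q.mkQ 1)) (Submodule.smul_mem_smul hb Submodule.mem_top) (by
      rw [smul_smul, Prod.smul_mk, smul_zero, ← map_smul, smul_eq_mul, mul_one, hQ]
      rfl)
    rw [Prod.smul_mk, ← map_smul, smul_eq_mul, mul_one] at h1
    exact congrArg Prod.snd h1

end FilterRegular

/-! ### Superficial elements -/

section Superficial

theorem reesMonomial_mem_pow {S : Type*} [CommRing S] {I : Ideal S} {W : Ideal (reesAlgebra I)}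
    (hW : ∀ y (hy : y ∈ I ^ 1), reesMonomial I 1 y hy ∈ W) (n : ℕ) (z : S) (hz : z ∈ I ^ n) :
    reesMonomial I n z hz ∈ W ^ n := by
  induction n generalizing z with
  | zero => simp
  | succ n ih =>
    have hz' := hz
    rw [pow_succ'] at hz'
    suffices H : ∀ hz : z ∈ I ^ (n + 1), reesMonomial I (n + 1) z hz ∈ W ^ (n + 1) from H hz
    clear hz
    induction hz' using Submodule.mul_induction_on' with
    | mem_mul_mem y hy w hw =>
      intro hz
      have : reesMonomial I (n + 1) (y * w) hz =
          reesMonomial I 1 y (by simpa using hy) * reesMonomial I n w hw := by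
        rw [reesMonomial_mul]
        apply Subtype.ext
        simp only [reesMonomial, add_comm]
      rw [this, pow_succ']
      exact Ideal.mul_mem_mul (hW y _) (ih w hw)
    | add y hy w hw ihy ihw =>
      intro hz
      rw [← pow_succ'] at hy hw
      have : reesMonomial I (n + 1) (y + w) hz =
          reesMonomial I (n + 1) y hy + reesMonomial I (n + 1) w hw :=
        Subtype.ext (map_add _ _ _)
      rw [this]
      exact Ideal.add_mem _ (ihy hy) (ihw hw)

variable {R : Type*} [CommRing R]

/-- The map `J → R'[J R' t]` that sends `x` to `x t`. -/
def degreeOneMap (S : Type*) [CommRing S] [Algebra R S] (J : Ideal R) :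
    J →ₗ[R] reesAlgebra (J.map (algebraMap R S)) where
  toFun x := reesMonomial _ 1 (algebraMap R S x) (by
    rw [pow_one]; exact Ideal.mem_map_of_mem _ x.2)
  map_add' x y := Subtype.ext (by simp [reesMonomial])
  map_smul' c x := Subtype.ext (by
    simp [reesMonomial, Algebra.smul_def])

theorem reesMonomial_mem_span_range (S : Type*) [CommRing S] [Algebra R S] (J : Ideal R) (y : S)
    (hy : y ∈ (J.map (algebraMap R S)) ^ 1) :
    reesMonomial _ 1 y hy ∈ Ideal.span (Set.range (degreeOneMap S J)) := by
  suffices H : ∀ y ∈ J.map (algebraMap R S), ∀ hy : y ∈ (J.map (algebraMap R S)) ^ 1,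
      reesMonomial _ 1 y hy ∈ Ideal.span (Set.range (degreeOneMap S J)) from
    H y (by rwa [pow_one] at hy) hy
  intro y hy
  induction hy using Submodule.span_induction with
  | mem y hy =>
    obtain ⟨x, hx, rfl⟩ := hy
    exact fun _ => Ideal.subset_span ⟨⟨x, hx⟩, rfl⟩
  | zero =>
    intro hy
    convert Ideal.zero_mem _ using 1
    exact Subtype.ext (by simp [reesMonomial])
  | add y z hy hz ihy ihz =>
    intro hyz
    have : reesMonomial (J.map (algebraMap R S)) 1 (y + z) hyz =
        reesMonomial _ 1 y (by rw [pow_one]; exact hy) +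
          reesMonomial _ 1 z (by rw [pow_one]; exact hz) :=
      Subtype.ext (map_add _ _ _)
    rw [this]
    exact Ideal.add_mem _ (ihy _) (ihz _)
  | smul c y hy ih =>
    intro hcy
    have : reesMonomial (J.map (algebraMap R S)) 1 (c • y) hcy =
        algebraMap S (reesAlgebra _) c * reesMonomial _ 1 y (by rw [pow_one]; exact hy) :=
      Subtype.ext (by
        change Polynomial.monomial 1 (c * y) = Polynomial.C c * Polynomial.monomial 1 y
        rw [Polynomial.C_mul_monomial])
    rw [this]
    exact Ideal.mul_mem_left _ _ (ih _)

/-- The map `I → R[It]` that sends `a` to `a t`. -/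
def reesDegreeOne (I : Ideal R) : I →ₗ[R] reesAlgebra I where
  toFun a := reesMonomial I 1 a (by simp)
  map_add' x y := Subtype.ext (by simp [reesMonomial])
  map_smul' c x := Subtype.ext (by simp [reesMonomial, Polynomial.smul_monomial])

theorem reesMonomial_mem_span_range_reesDegreeOne {I : Ideal R} (y : R) (hy : y ∈ I ^ 1) :
    reesMonomial I 1 y hy ∈ Ideal.span (Set.range (reesDegreeOne I)) :=
  Ideal.subset_span ⟨⟨y, by simpa using hy⟩, rfl⟩

variable [IsLocalRing R] [Infinite (ResidueField R)]

theorem exists_superficial (S : Type*) [CommRing S] [Algebra R S] [IsNoetherianRing S]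
    (J : Ideal R) :
    ∃ x ∈ J, ∃ n, ∀ r ≥ n, ∀ z ∈ (J.map (algebraMap R S)) ^ r,
      algebraMap R S x * z ∈ (J.map (algebraMap R S)) ^ (r + 2) →
        z ∈ (J.map (algebraMap R S)) ^ (r + 1) := by
  set 𝔞 := J.map (algebraMap R S) with h𝔞
  obtain ⟨x, n, hx⟩ := exists_filterRegular_quotient (degreeOneMap S J)
    (𝔞.map (algebraMap S (reesAlgebra 𝔞))) ⊥
  refine ⟨x, x.2, n, fun r hr z hz hxz => ?_⟩
  have h1 := (hx (reesMonomial 𝔞 r z hz) (Ideal.pow_le_pow_right hr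
    (reesMonomial_mem_pow (reesMonomial_mem_span_range S J) r z hz))).1 (by
    change reesMonomial 𝔞 1 (algebraMap R S x)
      (by rw [pow_one]; exact Ideal.mem_map_of_mem _ x.2) * _ ∈ _
    rw [reesMonomial_mul, reesMonomial_mem_map_iff, ← pow_succ', add_comm 1 r]
    exact hxz)
  rwa [reesMonomial_mem_map_iff, ← pow_succ'] at h1

/-- Working over R[It] handles all powers of `I` at once, so the bound on `r` does not depend on
`s`. -/
theorem exists_superficial_mul_pow [IsNoetherianRing R] (J I : Ideal R) :
    ∃ x ∈ J, ∃ n, ∀ r ≥ n, ∀ s, ∀ z ∈ J ^ r * I ^ s,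
      x * z ∈ J ^ (r + 2) * I ^ s → z ∈ J ^ (r + 1) * I ^ s := by
  obtain ⟨x, hx, n, h⟩ := exists_superficial (reesAlgebra I) J
  refine ⟨x, hx, n, fun r hr s z hz hxz => ?_⟩
  have hzs : z ∈ I ^ s := Ideal.mul_le_right hz
  have h1 := h r hr (reesMonomial I s z hzs) (by
    rwa [← Ideal.map_pow, reesMonomial_mem_map_iff]) (by
    have : algebraMap R (reesAlgebra I) x * reesMonomial I s z hzs =
        reesMonomial I s (x * z) (Ideal.mul_mem_left _ _ hzs) :=
      Subtype.ext (by
        change Polynomial.C x * Polynomial.monomial s z = Polynomial.monomial s (x * z)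
        rw [Polynomial.C_mul_monomial])
    rwa [this, ← Ideal.map_pow, reesMonomial_mem_map_iff])
  rwa [← Ideal.map_pow, reesMonomial_mem_map_iff] at h1

end Superficial

/-! ### Positive depth of blowup rings -/

section Depth

variable {R : Type*} [CommRing R] [IsLocalRing R]

theorem one_le_idealGrade_iff {A : Type*} [CommRing A] {J : Ideal A} (hJ : J ≠ ⊤) :
    1 ≤ idealGrade J ↔ ∃ g ∈ J, ∀ f, g * f = 0 → f = 0 := by
  constructor
  · intro h
    have h' : 0 < idealGrade J := lt_of_lt_of_le one_pos h
    rw [idealGrade, lt_iSup_iff] at h'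
    obtain ⟨rs, h'⟩ := h'
    rw [lt_iSup_iff] at h'
    obtain ⟨⟨hreg, hmem⟩, h'⟩ := h'
    match rs, hreg, hmem, h' with
    | [], _, _, h' => simp at h'
    | g :: rs, hreg, hmem, _ =>
      rw [RingTheory.Sequence.isRegular_cons_iff] at hreg
      exact ⟨g, hmem g (by simp), fun f hf => hreg.1.right_eq_zero_of_smul hf⟩
  · rintro ⟨g, hg, h⟩
    refine le_trans ?_ (le_iSup₂_of_le [g] ⟨⟨?_, ?_⟩, ?_⟩ le_rfl)
    · simp
    · rw [RingTheory.Sequence.isWeaklyRegular_cons_iff]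
      refine ⟨fun a b hab => ?_, RingTheory.Sequence.IsWeaklyRegular.nil _ _⟩
      exact sub_eq_zero.mp (h _ ((mul_sub g a b).trans (sub_eq_zero.mpr hab)))
    · intro htop
      apply hJ
      rw [eq_top_iff, htop, Ideal.ofList_singleton, smul_eq_mul, Ideal.mul_top,
        Ideal.span_singleton_le_iff_mem]
      exact hg
    · simpa using hg

theorem map_reesMaximalIdeal_ne_top (I : Ideal R) {J : Ideal R} (hJ : J ≤ maximalIdeal R) :
    (reesMaximalIdeal I).map
      (Ideal.Quotient.mk (J.map (algebraMap R (reesAlgebra I)))) ≠ ⊤ := by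
  intro h
  have h1 : J.map (algebraMap R (reesAlgebra I)) ≤ reesMaximalIdeal I := by
    rw [Ideal.map_le_iff_le_comap]
    intro j hj
    change (Polynomial.C j).coeff 0 ∈ maximalIdeal R
    rw [Polynomial.coeff_C_zero]
    exact hJ hj
  have h2 := congrArg (Ideal.comap (Ideal.Quotient.mk (J.map (algebraMap R (reesAlgebra I))))) h
  rw [Ideal.comap_map_of_surjective _ Ideal.Quotient.mk_surjective, Ideal.comap_top,
    ← RingHom.ker_eq_comap_bot, Ideal.mk_ker, sup_eq_left.mpr h1,
    Ideal.eq_top_iff_one] at h2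
  change (1 : Polynomial R).coeff 0 ∈ maximalIdeal R at h2
  rw [Polynomial.coeff_one_zero] at h2
  exact (Ideal.ne_top_iff_one _).mp (maximalIdeal.isMaximal R).ne_top h2

theorem one_le_blowupDepth {I J : Ideal R} (hJ : J ≤ maximalIdeal R)
    {a : I} (ha : IsRegular (degreeOne I J a)) : 1 ≤ blowupDepth I J := by
  refine (one_le_idealGrade_iff (map_reesMaximalIdeal_ne_top I hJ)).mpr
    ⟨degreeOne I J a, Ideal.mem_map_of_mem _ ?_, fun f hf => ha.left (hf.trans (mul_zero _).symm)⟩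
  change (Polynomial.monomial 1 (a : R)).coeff 0 ∈ maximalIdeal R
  simp [Polynomial.coeff_monomial]

/-- A regular element of the maximal homogeneous ideal of the fiber cone may be taken in the
irrelevant ideal. -/
theorem exists_mem_span_range_of_one_le_blowupDepth {I : Ideal R}
    (h : 1 ≤ blowupDepth I (maximalIdeal R)) :
    ∃ w ∈ Ideal.span (Set.range (reesDegreeOne I)),
      ∀ f, w * f ∈ (maximalIdeal R).map (algebraMap R (reesAlgebra I)) →
        f ∈ (maximalIdeal R).map (algebraMap R (reesAlgebra I)) := by
  obtain ⟨g, hg, hreg⟩ := (one_le_idealGrade_iff (map_reesMaximalIdeal_ne_top I le_rfl)).mp h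
  obtain ⟨g, hg', rfl⟩ := (Ideal.mem_map_iff_of_surjective _ Ideal.Quotient.mk_surjective).mp hg
  have hc : (g : Polynomial R).coeff 0 ∈ maximalIdeal R := hg'
  have hsum : g = reesMonomial I 0 ((g : Polynomial R).coeff 0) (g.2 0) +
      ∑ n ∈ (g : Polynomial R).support.erase 0,
        reesMonomial I n ((g : Polynomial R).coeff n) (g.2 n) := by
    apply Subtype.ext
    rw [AddMemClass.coe_add, AddSubmonoidClass.coe_finsetSum]
    conv_lhs => rw [(g : Polynomial R).as_sum_support]
    by_cases h0 : 0 ∈ (g : Polynomial R).support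
    · exact (Finset.add_sum_erase _ _ h0).symm
    · rw [Finset.erase_eq_of_notMem h0]
      simp only [reesMonomial, Polynomial.notMem_support_iff.mp h0, map_zero, zero_add]
  -- The constant term lies in 𝔪, hence vanishes in F(I) and may be dropped.
  refine ⟨∑ n ∈ (g : Polynomial R).support.erase 0,
        reesMonomial I n ((g : Polynomial R).coeff n) (g.2 n), ?_, fun f hf => ?_⟩
  · refine Ideal.sum_mem _ fun n hn => ?_
    exact Ideal.pow_le_self (Finset.ne_of_mem_erase hn)
      (reesMonomial_mem_pow reesMonomial_mem_span_range_reesDegreeOne n _ _)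
  · rw [← Ideal.Quotient.eq_zero_iff_mem]
    apply hreg
    rw [← map_mul, Ideal.Quotient.eq_zero_iff_mem, hsum, add_mul]
    exact Ideal.add_mem _ (Ideal.mul_mem_right _ _ (reesMonomial_mem_map (by simpa using hc))) hf

end Depth

/-! ### Existence of a pair with `a` regular on the fiber cone -/

section Existence

variable {R : Type*} [CommRing R] [IsLocalRing R] [Infinite (ResidueField R)]
  [IsNoetherianRing R]

theorem exists_filterRegular_fiberCone {I : Ideal R} (h : 1 ≤ blowupDepth I (maximalIdeal R))
    (Q : Ideal R) :
    ∃ a : I, IsRegular (degreeOne I (maximalIdeal R) a : FiberCone I) ∧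
      ∃ n, ∀ s ≥ n, ∀ z ∈ I ^ s, (a : R) * z ∈ Q * I ^ (s + 1) → z ∈ Q * I ^ s := by
  obtain ⟨w, hw, hwreg⟩ := exists_mem_span_range_of_one_le_blowupDepth h
  obtain ⟨a, n, ha⟩ := exists_filterRegular_quotient (reesDegreeOne I)
    (Q.map (algebraMap R (reesAlgebra I))) ((maximalIdeal R).map (algebraMap R (reesAlgebra I)))
  have hmul (k : ℕ) (z : R) (hz : z ∈ I ^ k) : reesDegreeOne I a * reesMonomial I k z hz =
      reesMonomial I (1 + k) (a * z)
        (by rw [pow_add, pow_one]; exact Ideal.mul_mem_mul a.2 hz) :=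
    reesMonomial_mul (by simp) hz
  refine ⟨a, isRegular_degreeOne fun k y hy hay => ?_, n, fun s hs z hz haz => ?_⟩
  · have hpow (m : ℕ) : ∀ f, w ^ m * f ∈ (maximalIdeal R).map (algebraMap R (reesAlgebra I)) →
        f ∈ (maximalIdeal R).map (algebraMap R (reesAlgebra I)) := by
      induction m with
      | zero => simp
      | succ m ih => exact fun f hf => ih f (hwreg _ (by rwa [← mul_assoc, ← pow_succ']))
    rw [← reesMonomial_mem_map_iff hy]
    -- Filter-regularity only tests elements of high irrelevant powers; multiplying by wⁿ moves
    -- there, and `w` is cancelled because it is regular on F(I).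
    refine hpow n _ ((ha _ (Ideal.mul_mem_right _ _ (Ideal.pow_mem_pow hw n))).2 ?_)
    rw [mul_left_comm, hmul]
    exact Ideal.mul_mem_left _ _ (reesMonomial_mem_map (by rwa [add_comm 1 k]))
  · rw [← reesMonomial_mem_map_iff hz]
    refine (ha _ (Ideal.pow_le_pow_right hs
      (reesMonomial_mem_pow reesMonomial_mem_span_range_reesDegreeOne s z hz))).1 ?_
    rw [hmul, reesMonomial_mem_map_iff, add_comm 1 s]
    exact haz

theorem exists_reduction_of_one_le_blowupDepth {I : Ideal R} {e : ℕ → ℕ → ℤ}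
    (he : IsBhattacharyaPolynomial 2 (maximalIdeal R) I e)
    (h : 1 ≤ blowupDepth I (maximalIdeal R)) (M : ℕ) :
    ∃ x ∈ maximalIdeal R, ∃ a : I, IsRegular (degreeOne I (maximalIdeal R) a : FiberCone I) ∧
      ∃ r ≥ M, ∃ s ≥ M, maximalIdeal R ^ (r + 1) * I ^ (s + 1) =
        Ideal.span {x} * (maximalIdeal R ^ r * I ^ (s + 1)) ⊔
          Ideal.span {(a : R)} * (maximalIdeal R ^ (r + 1) * I ^ s) := by
  obtain ⟨N, H, hH⟩ := he.exists_colength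
  obtain ⟨x, hx, n, hxn⟩ := exists_superficial_mul_pow (maximalIdeal R) I
  set 𝔪 := maximalIdeal R
  obtain ⟨r, hrM, hrN, hrn⟩ : ∃ r, M ≤ r ∧ N ≤ r ∧ n ≤ r := ⟨M + N + n, by omega⟩
  -- The exponent `r` is fixed first because `a` depends on `Q`. The summand 𝔪^(r+2) is an error
  -- term, removed at the end by Nakayama.
  let Q : Ideal R := Ideal.span {x} * 𝔪 ^ r ⊔ 𝔪 ^ (r + 2)
  obtain ⟨a, hareg, n', han⟩ := exists_filterRegular_fiberCone h Q
  obtain ⟨s, hsM, hsN, hsn⟩ : ∃ s, M ≤ s ∧ N ≤ s ∧ n' ≤ s := ⟨M + N + n', by omega⟩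
  refine ⟨x, hx, a, hareg, r, hrM, s, hsM, ?_⟩
  have hxm : Ideal.span {x} * 𝔪 ^ r ≤ 𝔪 ^ (r + 1) := by
    rw [pow_succ']
    exact Ideal.mul_mono_left (by rwa [Ideal.span_singleton_le_iff_mem])
  have hQle : Q ≤ 𝔪 ^ (r + 1) := sup_le hxm (Ideal.pow_le_pow_right (by omega))
  have hQ (t : ℕ) : Q * I ^ t = Ideal.span {x} * (𝔪 ^ r * I ^ t) ⊔ 𝔪 ^ (r + 2) * I ^ t := by
    rw [Ideal.sup_mul, mul_assoc]
  have h1 (t : ℕ) : colength (𝔪 ^ (r + 1) * I ^ t) + colength (Q * I ^ t) =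
      colength (𝔪 ^ r * I ^ t) + colength (𝔪 ^ (r + 2) * I ^ t) := by
    rw [hQ]
    refine colength_mul_sup (Ideal.mul_mono_left (Ideal.pow_le_pow_right (by omega)))
      fun z hz => ⟨hxn r hrn t z hz, fun hz' => ?_⟩
    rw [pow_succ' 𝔪 (r + 1), mul_assoc]
    exact Ideal.mul_mem_mul hx hz'
  have h2 : colength (Q * I ^ s) +
      colength (Ideal.span {(a : R)} * (𝔪 ^ (r + 1) * I ^ s) ⊔ Q * I ^ (s + 1)) =
      colength (𝔪 ^ (r + 1) * I ^ s) + colength (Q * I ^ (s + 1)) := by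
    refine colength_mul_sup (Ideal.mul_mono_left hQle)
      fun z hz => ⟨han s hsn z (Ideal.mul_le_right hz), fun hz' => ?_⟩
    rw [pow_succ', mul_left_comm]
    exact Ideal.mul_mem_mul a.2 hz'
  have haI : Ideal.span {(a : R)} * (𝔪 ^ (r + 1) * I ^ s) ≤ 𝔪 ^ (r + 1) * I ^ (s + 1) := by
    rw [pow_succ' I, mul_left_comm]
    exact Ideal.mul_mono_right
      (Ideal.mul_mono_left (by rw [Ideal.span_singleton_le_iff_mem]; exact a.2))
  have hle : Ideal.span {(a : R)} * (𝔪 ^ (r + 1) * I ^ s) ⊔ Q * I ^ (s + 1) ≤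
      𝔪 ^ (r + 1) * I ^ (s + 1) := sup_le haI (Ideal.mul_mono_left hQle)
  have heq : Ideal.span {(a : R)} * (𝔪 ^ (r + 1) * I ^ s) ⊔ Q * I ^ (s + 1) =
      𝔪 ^ (r + 1) * I ^ (s + 1) := by
    -- The two colengths differ by the second difference in `r` and first in `s` of a polynomial of
    -- total degree two, which is zero.
    obtain ⟨a1, b1⟩ := hH r hrN s hsN
    obtain ⟨a2, b2⟩ := hH (r + 1) (by omega) s hsN
    obtain ⟨a3, b3⟩ := hH (r + 2) (by omega) s hsN
    obtain ⟨a4, b4⟩ := hH r hrN (s + 1) (by omega)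
    obtain ⟨a5, b5⟩ := hH (r + 1) (by omega) (s + 1) (by omega)
    obtain ⟨a6, b6⟩ := hH (r + 2) (by omega) (s + 1) (by omega)
    have h3 := h1 s
    have h4 := h1 (s + 1)
    rw [a1, a2, a3] at h3
    rw [a4, a5, a6] at h4
    rw [a2] at h2
    refine eq_of_colength_le hle (by rw [a5]; exact ENat.natCast_ne_top _) ?_
    rw [a5]
    generalize colength (Q * I ^ s) = q at h2 h3
    generalize colength (Q * I ^ (s + 1)) = q' at h2 h4
    generalize colength (Ideal.span {(a : R)} * (𝔪 ^ (r + 1) * I ^ s) ⊔ Q * I ^ (s + 1)) = p at h2 ⊢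
    have hq : q ≠ ⊤ := by
      rintro rfl
      exact ENat.natCast_ne_top (H r s + H (r + 2) s) (by rw [Nat.cast_add, ← h3, add_top])
    have hq' : q' ≠ ⊤ := by
      rintro rfl
      exact ENat.natCast_ne_top (H r (s + 1) + H (r + 2) (s + 1))
        (by rw [Nat.cast_add, ← h4, add_top])
    lift q to ℕ using hq
    lift q' to ℕ using hq'
    have hp : p ≠ ⊤ := by
      rintro rfl
      exact ENat.natCast_ne_top (H (r + 1) s + q') (by rw [Nat.cast_add, ← h2, add_top])
    lift p to ℕ using hp
    norm_cast at h2 h3 h4 ⊢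
    zify at h2 h3 h4 ⊢
    rw [b2] at h2
    rw [b1, b2, b3] at h3
    rw [b4, b5, b6] at h4
    rw [b5]
    push_cast at *
    linarith
  refine le_antisymm ?_ (sup_le (by rw [← mul_assoc]; exact Ideal.mul_mono_left hxm) haI)
  refine Submodule.le_of_le_smul_of_le_jacobson_bot (I := 𝔪)
    (Ideal.fg_of_isNoetherianRing _) (maximalIdeal_le_jacobson _) ?_
  conv_lhs => rw [← heq, hQ]
  rw [smul_eq_mul, ← mul_assoc 𝔪, ← pow_succ' 𝔪 (r + 1)]
  refine sup_le (le_sup_of_le_left le_sup_right) (sup_le (le_sup_of_le_left le_sup_left) ?_)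
  exact le_sup_right

end Existence

end BlowupDepth

end

theorem mainTheorem5 {R : Type*} [CommRing R] [IsLocalRing R]
    (hinf : Infinite (IsLocalRing.ResidueField R))
    (hCM : BlowupDepth.IsCohenMacaulayLocal R)
    (hdim : ringKrullDim R = 2)
    (I : Ideal R) (hI : I.radical = IsLocalRing.maximalIdeal R)
    (hmin : BlowupDepth.HasMinimalMixedMultiplicity I) :
    (∀ (x : R) (a : I),
      BlowupDepth.IsJointReduction ![IsLocalRing.maximalIdeal R, I] ![x, (a : R)] →
      IsRegular (BlowupDepth.degreeOne I (IsLocalRing.maximalIdeal R) a :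
        BlowupDepth.FiberCone I) →
      IsRegular (BlowupDepth.degreeOne I I a : BlowupDepth.AssocGraded I)) ∧
    (1 ≤ BlowupDepth.blowupDepth I (IsLocalRing.maximalIdeal R) →
      1 ≤ BlowupDepth.blowupDepth I I) := by
  have := hCM.1
  obtain ⟨e, he, hμ⟩ := hmin.exists_isBhattacharyaPolynomial hdim hI
  obtain ⟨N, hN⟩ := BlowupDepth.isRegular_degreeOne_assocGraded hCM hdim hI he hμ
  refine ⟨fun x a hjr hreg => ?_, fun h => ?_⟩
  · obtain ⟨hx, -, n, hn⟩ := hjr.pow_mul_pow_eq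
    exact hN x hx a (N + n) (by omega) (N + n) (by omega)
      (hn (N + n) (by omega) (N + n) (by omega)) hreg
  · obtain ⟨x, hx, a, hreg, r, hr, s, hs, hrs⟩ :=
      BlowupDepth.exists_reduction_of_one_le_blowupDepth he h N
    exact BlowupDepth.one_le_blowupDepth (hI ▸ Ideal.le_radical) (hN x hx a r hr s hs hrs hreg)
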